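/- Let $k$ be an algebraically closed field of characteristic zero (for example $k=\mathbb{C}$) and let $H$ be a Hopf algebra over $k$ that is semisimple as a ring. Assume that $H$ is almost cocommutative: there is an invertible element $R\in H\otimes_k H$ with $\tau(\Delta(h))=R\,\Delta(h)\,R^{-1}$ for all $h\in H$, where $\Delta$ is the comultiplication and $\tau$ the flip of $H\otimes_k H$. Let ${}_H\mathcal{M}$ be the tensor category of finite dimensional left $H$-modules. A grading of a tensor category $\mathcal{C}$ by a group $G$ is a decomposition $\mathcal{C}=\bigoplus_{x\in G}\mathcal{C}_x$ into a direct sum of full abelian subcategories such that $\otimes$ maps $\mathcal{C}_x\times\mathcal{C}_y$ to $\mathcal{C}_{xy}$ for all $x,y\in G$; it is faithful if every $\mathcal{C}_x$ is nonzero. The universal grading group $U(\mathcal{C})$ is the group $U$ of a faithful grading $\mathcal{C}=\bigoplus_{u\in U}\mathcal{C}_u$ that is universal: for every grading $\mathcal{C}=\bigoplus_{x\in G}\mathcal{C}'_x$ by a group $G$ there is a unique group homomorphism $\varphi:U\to G$ with $\mathcal{C}_u\subseteq\mathcal{C}'_{\varphi(u)}$ for all $u\in U$. Then ${}_H\mathcal{M}$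 has a universal grading, and its universal grading group is isomorphic to the group of central group-like elements of $H$: $$U({}_H\mathcal{M})\;\cong\; Z(H)\cap G(H),$$ where $Z(H)$ is the center of $H$ and $G(H)$ is the group of group-like elements of $H$ (the $g\in H$ with $\Delta(g)=g\otimes g$ and $\varepsilon(g)=1$). -/

import Mathlib

open CategoryTheory CategoryTheory.Limits MonoidalCategory
open scoped TensorProduct

universe w v u

noncomputable section

/-! ### The action of a Hopf algebra on tensor products -/

section TensorAction

variable {k : Type u} [Field k]
variable {A : Type*} [Ring A] [Algebra k A] {B : Type*} [Ring B] [Algebra k B]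
variable {H : Type v} [Ring H] [HopfAlgebra k H]
variable {V : Type*} [AddCommGroup V] [Module k V] {W : Type*} [AddCommGroup W] [Module k W]
  {X : Type*} [AddCommGroup X] [Module k X]
  {V' : Type*} [AddCommGroup V'] [Module k V'] {W' : Type*} [AddCommGroup W'] [Module k W']

namespace TensorAction

/-- If `A` acts on `V` and `B` acts on `W`, then `A ⊗ B` acts on `V ⊗ W` by
`(a ⊗ b)(v ⊗ w) = av ⊗ bw`. -/
def extAct (ρ : A →ₐ[k] Module.End k V) (σ : B →ₐ[k] Module.End k W) :
    A ⊗[k] B →ₐ[k] Module.End k (V ⊗[k] W) :=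
  (Module.endTensorEndAlgHom (R := k) (S := k) (A := k)).comp (Algebra.TensorProduct.map ρ σ)

/-- The action of a Hopf algebra `H` on `V ⊗ W` through the comultiplication. -/
def comulAct (ρ : H →ₐ[k] Module.End k V) (σ : H →ₐ[k] Module.End k W) :
    H →ₐ[k] Module.End k (V ⊗[k] W) :=
  (extAct ρ σ).comp (Bialgebra.comulAlgHom k H)

variable (k H) in
/-- The action of a Hopf algebra `H` on the ground field through the counit. -/
def counitAct : H →ₐ[k] Module.End k k :=
  (Algebra.lmul k k).comp (Bialgebra.counitAlgHom k H)

lemma extAct_tmul (ρ : A →ₐ[k] Module.End k V) (σ : B →ₐ[k] Module.End k W) (a : A) (b : B)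
    (v : V) (w : W) : extAct ρ σ (a ⊗ₜ b) (v ⊗ₜ w) = ρ a v ⊗ₜ σ b w := rfl

lemma comulAct_apply (ρ : H →ₐ[k] Module.End k V) (σ : H →ₐ[k] Module.End k W) (h : H) :
    comulAct ρ σ h = extAct ρ σ (Coalgebra.comul h) := rfl

lemma counitAct_apply (h : H) (c : k) :
    counitAct k H h c = Coalgebra.counit (R := k) h * c := rfl

lemma comulAct_map (ρ : H →ₐ[k] Module.End k V) (σ : H →ₐ[k] Module.End k W)
    (ρ' : H →ₐ[k] Module.End k V') (σ' : H →ₐ[k] Module.End k W')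
    (f : V →ₗ[k] V') (g : W →ₗ[k] W') (hf : ∀ h v, f (ρ h v) = ρ' h (f v))
    (hg : ∀ h w, g (σ h w) = σ' h (g w)) (h : H) (t : V ⊗[k] W) :
    TensorProduct.map f g (comulAct ρ σ h t) =
      comulAct ρ' σ' h (TensorProduct.map f g t) := by
  rw [comulAct_apply, comulAct_apply]
  generalize (Coalgebra.comul h : H ⊗[k] H) = x
  induction x with
  | zero => simp
  | add x y hx hy => simp only [map_add, LinearMap.add_apply, hx, hy]
  | tmul a b =>
    induction t with
    | zero => simp
    | add s t hs ht => simp only [map_add, hs, ht]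
    | tmul m n => simp [extAct_tmul, hf, hg]

lemma comulAct_assoc (ρ : H →ₐ[k] Module.End k V) (σ : H →ₐ[k] Module.End k W)
    (τ : H →ₐ[k] Module.End k X) (h : H) (t : (V ⊗[k] W) ⊗[k] X) :
    TensorProduct.assoc k V W X (comulAct (comulAct ρ σ) τ h t) =
      comulAct ρ (comulAct σ τ) h (TensorProduct.assoc k V W X t) := by
  have hL : ∀ y : H ⊗[k] H, extAct (comulAct ρ σ) τ y =
      extAct (extAct ρ σ) τ (Coalgebra.comul.rTensor H y) := by
    intro y
    induction y with
    | zero => simp only [map_zero]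
    | add x y hx hy => simp only [map_add, hx, hy]
    | tmul a b => rfl
  have hR : ∀ y : H ⊗[k] H, extAct ρ (comulAct σ τ) y =
      extAct ρ (extAct σ τ) (Coalgebra.comul.lTensor H y) := by
    intro y
    induction y with
    | zero => simp only [map_zero]
    | add x y hx hy => simp only [map_add, hx, hy]
    | tmul a b => rfl
  have key : ∀ (z : (H ⊗[k] H) ⊗[k] H) (t : (V ⊗[k] W) ⊗[k] X),
      TensorProduct.assoc k V W X (extAct (extAct ρ σ) τ z t) =
        extAct ρ (extAct σ τ) (TensorProduct.assoc k H H H z)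
          (TensorProduct.assoc k V W X t) := by
    intro z t
    induction z with
    | zero => simp only [map_zero, LinearMap.zero_apply]
    | add x y hx hy => simp only [map_add, LinearMap.add_apply, hx, hy]
    | tmul x c =>
      induction x with
      | zero => simp only [TensorProduct.zero_tmul, map_zero, LinearMap.zero_apply]
      | add x y hx hy =>
        simp only [TensorProduct.add_tmul, map_add, LinearMap.add_apply, hx, hy]
      | tmul a b =>
        induction t with
        | zero => simp only [map_zero]
        | add s t hs ht => simp only [map_add, hs, ht]
        | tmul s p =>
          induction s with
          | zero => simp only [TensorProduct.zero_tmul, map_zero]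
          | add s t hs ht => simp only [TensorProduct.add_tmul, map_add, hs, ht]
          | tmul m n => rfl
  rw [comulAct_apply, comulAct_apply, hL, hR, key, Coalgebra.coassoc_apply]

lemma comulAct_lid (ρ : H →ₐ[k] Module.End k V) (h : H) (t : k ⊗[k] V) :
    TensorProduct.lid k V (comulAct (counitAct k H) ρ h t) =
      ρ h (TensorProduct.lid k V t) := by
  have key : ∀ x : H ⊗[k] H, TensorProduct.lid k V (extAct (counitAct k H) ρ x t) =
      ρ (TensorProduct.lid k H (Coalgebra.counit.rTensor H x)) (TensorProduct.lid k V t) := by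
    intro x
    induction x with
    | zero => simp
    | add x y hx hy => simp only [map_add, LinearMap.add_apply, hx, hy]
    | tmul a b =>
      induction t with
      | zero => simp
      | add s t hs ht => simp only [map_add, hs, ht]
      | tmul c m => simp [extAct_tmul, counitAct_apply, mul_smul, smul_comm c]
  rw [comulAct_apply, key, Coalgebra.rTensor_counit_comul]
  simp

lemma comulAct_rid (ρ : H →ₐ[k] Module.End k V) (h : H) (t : V ⊗[k] k) :
    TensorProduct.rid k V (comulAct ρ (counitAct k H) h t) =
      ρ h (TensorProduct.rid k V t) := by
  have key : ∀ x : H ⊗[k] H, TensorProduct.rid k V (extAct ρ (counitAct k H) x t) =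
      ρ (TensorProduct.rid k H (Coalgebra.counit.lTensor H x)) (TensorProduct.rid k V t) := by
    intro x
    induction x with
    | zero => simp
    | add x y hx hy => simp only [map_add, LinearMap.add_apply, hx, hy]
    | tmul a b =>
      induction t with
      | zero => simp
      | add s t hs ht => simp only [map_add, hs, ht]
      | tmul m c => simp [extAct_tmul, counitAct_apply, mul_smul, smul_comm c]
  rw [comulAct_apply, key, Coalgebra.lTensor_counit_comul]
  simp

end TensorAction
end TensorAction

/-! ### The tensor category of finite dimensional modules over a Hopf algebra -/

section Modules

variable (k : Type u) [Field k] (H : Type v) [Ring H] [HopfAlgebra k H]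

/-- A finite dimensional left module over the `k`-algebra `H`: a finite dimensional `k`-vector
space `V` with an action map `H → End_k(V)` of `k`-algebras. -/
structure FDMod where
  /-- the underlying vector space -/
  V : Type u
  [addCommGroup : AddCommGroup V]
  [module : Module k V]
  [finite : Module.Finite k V]
  /-- the action of `H` -/
  act : H →ₐ[k] Module.End k V

namespace FDMod

attribute [instance] addCommGroup module finite

variable {k H}

/-- Homomorphisms of `H`-modules: `k`-linear maps that commute with the action of `H`. -/
@[ext]
structure Hom (M N : FDMod k H) where
  /-- the underlying linear map -/
  lin : M.V →ₗ[k] N.V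
  comm : ∀ (h : H) (m : M.V), lin (M.act h m) = N.act h (lin m)

instance : Category (FDMod k H) where
  Hom := Hom
  id M := ⟨LinearMap.id, fun _ _ => rfl⟩
  comp f g := ⟨g.lin ∘ₗ f.lin, fun h m => by simp [f.comm, g.comm]⟩

@[ext]
lemma hom_ext {M N : FDMod k H} {f g : M ⟶ N} (h : ∀ m, f.lin m = g.lin m) : f = g :=
  Hom.ext (LinearMap.ext h)

@[simp] lemma id_lin (M : FDMod k H) : Hom.lin (𝟙 M) = LinearMap.id := rfl

@[simp] lemma comp_lin {M N P : FDMod k H} (f : M ⟶ N) (g : N ⟶ P) :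
    Hom.lin (f ≫ g) = g.lin ∘ₗ f.lin := rfl

section Additive

variable {M N : FDMod k H}

instance : Zero (M ⟶ N) := ⟨⟨0, by simp⟩⟩
instance : Add (M ⟶ N) := ⟨fun f g => ⟨f.lin + g.lin, by simp [f.comm, g.comm]⟩⟩
instance : Neg (M ⟶ N) := ⟨fun f => ⟨-f.lin, by simp [f.comm]⟩⟩

@[simp] lemma zero_lin : Hom.lin (0 : M ⟶ N) = 0 := rfl
@[simp] lemma add_lin (f g : M ⟶ N) : Hom.lin (f + g) = f.lin + g.lin := rfl
@[simp] lemma neg_lin (f : M ⟶ N) : Hom.lin (-f) = -f.lin := rfl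

instance : AddCommGroup (M ⟶ N) where
  add_assoc f g h := by ext; simp [add_assoc]
  zero_add f := by ext; simp
  add_zero f := by ext; simp
  nsmul := nsmulRec
  zsmul := zsmulRec
  neg_add_cancel f := by ext; simp
  add_comm f g := by ext; simp [add_comm]

end Additive

instance : Preadditive (FDMod k H) where
  add_comp _ _ _ f g h := by ext; simp
  comp_add _ _ _ f g h := by ext; simp

/-- An `H`-linear bijection, as an isomorphism of `H`-modules. -/
def isoOfEquiv {M N : FDMod k H} (e : M.V ≃ₗ[k] N.V)
    (he : ∀ (h : H) (m : M.V), e (M.act h m) = N.act h (e m)) : M ≅ N where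
  hom := ⟨e, he⟩
  inv := ⟨e.symm, fun h n => by
    apply e.injective
    simp [he]⟩
  hom_inv_id := by ext; simp
  inv_hom_id := by ext; simp

/-- The tensor product of two `H`-modules, with `H` acting through the comultiplication:
`h (v ⊗ w) = ∑ h₍₁₎ v ⊗ h₍₂₎ w`. -/
def tensor (M N : FDMod k H) : FDMod k H where
  V := M.V ⊗[k] N.V
  act := TensorAction.comulAct M.act N.act

/-- The unit object: the ground field `k`, with `H` acting through the counit. -/
def unit : FDMod k H where
  V := k
  act := TensorAction.counitAct k H

/-- The tensor product of two homomorphisms of `H`-modules. -/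
def tensorMap {M M' N N' : FDMod k H} (f : M ⟶ M') (g : N ⟶ N') :
    tensor M N ⟶ tensor M' N' where
  lin := TensorProduct.map f.lin g.lin
  comm := TensorAction.comulAct_map M.act N.act M'.act N'.act f.lin g.lin f.comm g.comm

instance : MonoidalCategoryStruct (FDMod k H) where
  tensorObj := tensor
  whiskerLeft M _ _ f := tensorMap (𝟙 M) f
  whiskerRight f N := tensorMap f (𝟙 N)
  tensorHom := tensorMap
  tensorUnit := unit
  associator M N P := isoOfEquiv (TensorProduct.assoc k M.V N.V P.V) 
    (TensorAction.comulAct_assoc M.act N.act P.act)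
  leftUnitor M := isoOfEquiv (TensorProduct.lid k M.V) (TensorAction.comulAct_lid M.act)
  rightUnitor M := isoOfEquiv (TensorProduct.rid k M.V) (TensorAction.comulAct_rid M.act)

/-- The underlying vector space of an `H`-module. -/
def forgetToModule : FDMod k H ⥤ ModuleCat.{u} k where
  obj M := ModuleCat.of k M.V
  map f := ModuleCat.ofHom f.lin

instance : (forgetToModule (k := k) (H := H)).Faithful where
  map_injective h := Hom.ext (congrArg ModuleCat.Hom.hom h)

/-- The monoidal category of finite dimensional `H`-modules; all structure isomorphisms are those
of the underlying vector spaces. -/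
instance : MonoidalCategory (FDMod k H) :=
  Monoidal.induced forgetToModule
    { μIso := fun _ _ => Iso.refl _
      εIso := Iso.refl _
      whiskerLeft_eq := fun _ _ _ _ => rfl
      whiskerRight_eq := fun _ _ => rfl
      tensorHom_eq := fun _ _ => rfl
      associator_eq := fun _ _ _ =>
        ModuleCat.hom_ext (TensorProduct.ext_threefold fun _ _ _ => rfl)
      leftUnitor_eq := fun _ => ModuleCat.hom_ext (TensorProduct.ext' fun _ _ => rfl)
      rightUnitor_eq := fun _ => ModuleCat.hom_ext (TensorProduct.ext' fun _ _ => rfl) }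

end FDMod
end Modules

/-! ### Gradings of tensor categories by groups -/

section Grading

/-- A grading of an additive monoidal category `C` by a group `G`: a decomposition
`C = ⨁_{x ∈ G} C_x` into a direct sum of full subcategories such that `⊗` maps `C_x × C_y` into
`C_{xy}`. In an abelian category the axioms force every `C_x` to be closed under finite direct
sums, kernels, cokernels and direct summands, so that the `C_x` are full abelian subcategories. -/
structure GroupGrading (C : Type*) [Category C] [Preadditive C] [MonoidalCategory C]
    (G : Type*) [Group G] where
  /-- the objects of the homogeneous component `C_x` -/
  component : G → ObjectProperty C
  of_iso : ∀ {x : G} {X Y : C}, (X ≅ Y) → component x X → component x Y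
  zero_mem : ∀ (x : G) {X : C}, IsZero X → component x X
  /-- there are no nonzero morphisms between different components -/
  hom_eq_zero : ∀ {x y : G}, x ≠ y → ∀ {X Y : C}, component x X → component y Y →
    ∀ f : X ⟶ Y, f = 0
  /-- every object is a finite direct sum of homogeneous objects -/
  exists_decomposition : ∀ X : C, ∃ (S : Finset G) (Y : S → C) (b : Bicone Y),
    (∀ x : S, component x (Y x)) ∧ Nonempty b.IsBilimit ∧ Nonempty (X ≅ b.pt)
  tensor_mem : ∀ {x y : G} {X Y : C}, component x X → component y Y →
    component (x * y) (X ⊗ Y)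

/-- A grading is faithful if every homogeneous component is nonzero. -/
def GroupGrading.IsFaithful {C : Type*} [Category C] [Preadditive C] [MonoidalCategory C]
    {G : Type*} [Group G] (d : GroupGrading C G) : Prop :=
  ∀ x : G, ∃ X : C, d.component x X ∧ ¬ IsZero X

/-- A grading `d` of `C` by `U` is the universal grading (and `U` is the universal grading group of
`C`) if it is faithful and every grading of `C` by a group `G` is obtained from `d` along a unique
group homomorphism `φ : U → G`, i.e. `C_u ⊆ C_{φ(u)}` for all `u`. -/
def GroupGrading.IsUniversal {C : Type*} [Category C] [Preadditive C] [MonoidalCategory C]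
    {U : Type w} [Group U] (d : GroupGrading C U) : Prop :=
  d.IsFaithful ∧ ∀ (G : Type w) [Group G] (e : GroupGrading C G),
    ∃! φ : U →* G, ∀ (u : U) (X : C), d.component u X → e.component (φ u) X

end Grading

/-! ### Almost cocommutative Hopf algebras and central group-like elements -/

section Hopf

variable (k : Type u) [Field k] (H : Type v) [Ring H] [HopfAlgebra k H]

/-- `H` is almost cocommutative if there is an invertible `R ∈ H ⊗ H` with
`τ(Δ(h)) = R Δ(h) R⁻¹` for all `h ∈ H`, where `τ` is the flip of `H ⊗ H`. -/
def IsAlmostCocommutative : Prop :=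
  ∃ R : (H ⊗[k] H)ˣ, ∀ h : H,
    TensorProduct.comm k H H (Coalgebra.comul h) =
      (R : H ⊗[k] H) * Coalgebra.comul h * ((R⁻¹ : (H ⊗[k] H)ˣ) : H ⊗[k] H)

/-- The group `Z(H) ∩ G(H)` of central group-like elements of `H`. -/
def centralGroupLikes : Subgroup (GroupLike k H) where
  carrier := {g | (g : H) ∈ Subalgebra.center k H}
  mul_mem' {a b} ha hb := by
    simpa using mul_mem (S := Subalgebra k H) ha hb
  one_mem' := by simp
  inv_mem' {g} hg := by
    simp only [Set.mem_ofPred_eq, Subalgebra.mem_center_iff] at hg ⊢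
    intro b
    have h1 : ((g⁻¹ : GroupLike k H) : H) * (g : H) = 1 := by
      rw [← GroupLike.val_mul, inv_mul_cancel, GroupLike.val_one]
    have h2 : (g : H) * ((g⁻¹ : GroupLike k H) : H) = 1 := by
      rw [← GroupLike.val_mul, mul_inv_cancel, GroupLike.val_one]
    calc b * ((g⁻¹ : GroupLike k H) : H)
        = ((g⁻¹ : GroupLike k H) : H) * ((g : H) * b) * ((g⁻¹ : GroupLike k H) : H) := by
          rw [← mul_assoc, h1, one_mul]
      _ = ((g⁻¹ : GroupLike k H) : H) * b := by
          rw [← hg b, mul_assoc, mul_assoc, h2, mul_one]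

end Hopf

end

/-! Let C be the group of central group-like elements and Ĉ its character group. Group-likes are
linearly independent, so C is finite once H is finite dimensional. Every module splits into the
parts on which C acts through a character, and Δ(g) = g ⊗ g makes this a grading by Ĉ. It is
faithful because the idempotents e_χ of k[C] ⊆ H are nonzero (`characterGrading_isFaithful`).

For universality, take any grading by G. Splitting 1 in the regular module into homogeneous parts
yields elements of H that act on each component by prescribed scalars (`exists_scalar`). The degrees
that occur form a finite subgroup, abelian because V ⊗ W ≅ W ⊗ V. For a character ψ of this
subgroup, the element acting by ψ(x) in degree x is central and group-like
(`exists_centralGroupLike`). Hence no ψ separates the degrees of two nonzero homogeneous modules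
with the same character of C, and these degrees coincide (`exists_component_of_characterGrading`).
So the universal grading group is Ĉ, which is isomorphic to C, though not canonically, since k is
algebraically closed of characteristic zero.

Semisimplicity enters only through finite dimensionality, obtained from an integral of counit one
(`HopfAlgebra.finite_of_isSemisimpleRing`). -/

noncomputable section

/-! ### Semisimple Hopf algebras are finite dimensional -/

section FiniteDimensional

open Coalgebra HopfAlgebra

variable {k : Type u} [Field k] {H : Type v} [Ring H] [HopfAlgebra k H]

variable (k H) in
/-- A semisimple Hopf algebra has a left integral of counit one. -/
theorem exists_left_integral [IsSemisimpleRing H] :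
    ∃ Λ : H, (∀ h : H, h * Λ = counit (R := k) h • Λ) ∧ counit (R := k) Λ = 1 := by
  let I : Submodule H H := RingHom.ker (Bialgebra.counitAlgHom k H)
  have hI : ∀ h : H, h ∈ I ↔ counit (R := k) h = 0 := fun h => Iff.rfl
  -- Λ is the component of 1 in a complement J of the augmentation ideal I; then hΛ - ε(h)Λ lies in
  -- I ∩ J = 0.
  obtain ⟨J, hJ⟩ := exists_isCompl I
  obtain ⟨a, ha, Λ, hΛ, h1⟩ := Submodule.mem_sup.1
    (hJ.sup_eq_top ▸ Submodule.mem_top : (1 : H) ∈ I ⊔ J)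
  have hε : counit (R := k) Λ = 1 := by
    have := congrArg (counit (R := k)) h1
    rwa [map_add, (hI a).1 ha, zero_add, Bialgebra.counit_one] at this
  refine ⟨Λ, fun h => sub_eq_zero.1 ?_, hε⟩
  refine Submodule.disjoint_def.1 hJ.disjoint _ ?_ ?_
  · rw [hI, map_sub, Bialgebra.counit_mul, map_smul, hε]
    simp
  · refine J.sub_mem (J.smul_mem h hΛ) ?_
    rw [← one_mul Λ, ← Algebra.smul_mul_assoc]
    exact J.smul_mem _ hΛ

/-- `S(h₍₁₎)h₍₂₎ ⊗ h₍₃₎ = 1 ⊗ h`. -/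
theorem sum_antipode_mul_comul {ι : Type*} {h : H} (r : Repr k h ι) :
    ∑ i ∈ r.index, (antipode k (r.left i) ⊗ₜ[k] (1 : H)) * comul (r.right i) = 1 ⊗ₜ[k] h := by
  -- F sends a ⊗ b ⊗ c to S(a)b ⊗ c; coassociativity lets it be evaluated on either bracketing of
  -- the iterated comultiplication of h.
  let F : H ⊗[k] (H ⊗[k] H) →ₗ[k] H ⊗[k] H :=
    (LinearMap.mul' k H ∘ₗ (antipode k).rTensor H).rTensor H ∘ₗ
      (TensorProduct.assoc k H H H).symm.toLinearMap
  have hF : ∀ (a : H) (t : H ⊗[k] H), F (a ⊗ₜ t) = (antipode k a ⊗ₜ[k] (1 : H)) * t := by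
    intro a t
    induction t with
    | zero => simp
    | add x y hx hy => rw [TensorProduct.tmul_add, map_add, hx, hy, mul_add]
    | tmul b c => simp [F]
  have h1 : F (comul.lTensor H (comul h)) = 1 ⊗ₜ[k] h := by
    rw [← Coalgebra.coassoc_apply]
    have h2 : ∀ t : H ⊗[k] H, F (TensorProduct.assoc k H H H (comul.rTensor H t)) =
        (Algebra.linearMap k H ∘ₗ counit).rTensor H t := by
      intro t
      rw [← mul_antipode_rTensor_comul]
      simp only [F, LinearMap.comp_apply, LinearEquiv.coe_coe, LinearEquiv.symm_apply_apply]
      rw [← LinearMap.comp_apply, ← LinearMap.rTensor_comp, LinearMap.comp_assoc]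
    rw [h2, LinearMap.rTensor_comp, LinearMap.comp_apply, Coalgebra.rTensor_counit_comul]
    simp
  rw [← h1, ← r.eq]
  simp [hF]

/-- Expand 1 ⊗ h as ∑ (S(h₍₁₎) ⊗ 1)Δ(h₍₂₎). Since Δ(h₍₂₎)Δ(Λ) = ε(h₍₂₎)Δ(Λ), the counit absorbs
h₍₂₎. -/
theorem antipode_tmul_one_mul_comul {Λ : H} (hΛ : ∀ h : H, h * Λ = counit (R := k) h • Λ) (h : H) :
    (antipode k h ⊗ₜ[k] (1 : H)) * comul Λ = ((1 : H) ⊗ₜ[k] h) * comul Λ := by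
  rw [← sum_antipode_mul_comul (ℛ k h), Finset.sum_mul]
  have : ∀ i, (antipode k ((ℛ k h).left i) ⊗ₜ[k] (1 : H)) * comul ((ℛ k h).right i) * comul Λ =
      (antipode k (counit (R := k) ((ℛ k h).right i) • (ℛ k h).left i) ⊗ₜ[k] (1 : H)) *
        comul Λ := by
    intro i
    rw [mul_assoc, ← Bialgebra.comul_mul, hΛ, map_smul, map_smul, ← TensorProduct.smul_tmul',
      mul_smul_comm, smul_mul_assoc]
  simp only [this]
  have hr : ∑ i ∈ (ℛ k h).index, counit (R := k) ((ℛ k h).right i) • (ℛ k h).left i = h := by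
    have := congrArg (TensorProduct.rid k H) (sum_tmul_counit_eq (ℛ k h))
    simpa only [map_sum, TensorProduct.rid_tmul, one_smul] using this
  rw [← Finset.sum_mul, ← TensorProduct.sum_tmul, ← map_sum, hr]

variable (k H) in
/-- A semisimple Hopf algebra is finite dimensional. -/
theorem HopfAlgebra.finite_of_isSemisimpleRing [IsSemisimpleRing H] : Module.Finite k H := by
  classical
  obtain ⟨Λ, hΛ, hε⟩ := exists_left_integral k H
  let r := ℛ k Λ
  let b := Module.Basis.ofVectorSpace k H
  let c := TensorProduct.equivFinsuppOfBasisLeft (N := H) b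
  -- The span of the finitely many right legs of Δ(Λ); it turns out to be all of H.
  let L : Submodule k H := Submodule.span k (r.right '' r.index)
  -- Multiplying the right leg of Δ(Λ) by x amounts to multiplying the left leg by S(x), which keeps
  -- the right legs inside L.
  have hL : ∀ (x : H) j, x * c (comul Λ) j ∈ L := by
    intro x j
    have h1 : ∀ t : H ⊗[k] H, x * c t j = c (((1 : H) ⊗ₜ[k] x) * t) j := by
      intro t
      induction t with
      | zero => simp
      | add s t hs ht => simp only [map_add, Finsupp.add_apply, mul_add, hs, ht]
      | tmul m n => simp [c]
    rw [h1, ← antipode_tmul_one_mul_comul hΛ, ← r.eq, Finset.mul_sum, map_sum,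
      Finsupp.finsetSum_apply]
    refine Submodule.sum_mem _ fun i hi => ?_
    rw [Algebra.TensorProduct.tmul_mul_tmul, one_mul,
      TensorProduct.equivFinsuppOfBasisLeft_apply_tmul_apply]
    exact L.smul_mem _ (Submodule.subset_span ⟨i, hi, rfl⟩)
  have hfin : Module.Finite k L := Module.Finite.span_of_finite k (r.index.finite_toSet.image _)
  refine Module.Finite.of_surjective L.subtype fun h => ⟨⟨h, ?_⟩, rfl⟩
  -- With Δ(Λ) = ∑ b_j ⊗ c_j this reads ∑ S(b_j)c_j = ε(Λ) = 1, so h = ∑ (h S(b_j)) c_j lies in L.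
  have h1 : LinearMap.mul' k H ((antipode k).rTensor H (comul Λ)) = 1 := by
    rw [mul_antipode_rTensor_comul_apply, hε, map_one]
  rw [← c.symm_apply_apply (comul Λ), TensorProduct.equivFinsuppOfBasisLeft_symm_apply,
    Finsupp.sum, map_sum, map_sum] at h1
  rw [← mul_one h, ← h1, Finset.mul_sum]
  refine Submodule.sum_mem _ fun j _ => ?_
  rw [LinearMap.rTensor_tmul, LinearMap.mul'_apply, ← mul_assoc]
  exact hL _ j

end FiniteDimensional

/-! ### Modules over a Hopf algebra -/

section Modules

variable {k : Type u} [Field k] {H : Type v} [Ring H] [HopfAlgebra k H]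

theorem TensorAction.extAct_map {V W V' W' : Type*} [AddCommGroup V] [Module k V]
    [AddCommGroup W] [Module k W] [AddCommGroup V'] [Module k V'] [AddCommGroup W'] [Module k W']
    (ρ : H →ₐ[k] Module.End k V) (σ : H →ₐ[k] Module.End k W)
    (ρ' : H →ₐ[k] Module.End k V') (σ' : H →ₐ[k] Module.End k W')
    (f : V →ₗ[k] V') (g : W →ₗ[k] W') (hf : ∀ h v, f (ρ h v) = ρ' h (f v))
    (hg : ∀ h w, g (σ h w) = σ' h (g w)) (t : H ⊗[k] H) (v : V) (w : W) :
    TensorProduct.map f g (extAct ρ σ t (v ⊗ₜ w)) = extAct ρ' σ' t (f v ⊗ₜ g w) := by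
  induction t with
  | zero => simp
  | add x y hx hy => simp only [map_add, LinearMap.add_apply, hx, hy]
  | tmul a b => simp [extAct_tmul, hf, hg]

theorem TensorAction.comm_extAct {V W : Type*} [AddCommGroup V] [Module k V]
    [AddCommGroup W] [Module k W] (ρ : H →ₐ[k] Module.End k V) (σ : H →ₐ[k] Module.End k W)
    (t : H ⊗[k] H) (x : V ⊗[k] W) :
    TensorProduct.comm k V W (extAct ρ σ t x) =
      extAct σ ρ (TensorProduct.comm k H H t) (TensorProduct.comm k V W x) := by
  induction t with
  | zero => simp
  | add x y hx hy => simp only [map_add, LinearMap.add_apply, hx, hy]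
  | tmul a b =>
    induction x with
    | zero => simp
    | add x y hx hy => simp only [map_add, hx, hy]
    | tmul v w => simp [extAct_tmul]

namespace FDMod

theorem isZero_iff {X : FDMod k H} : IsZero X ↔ Subsingleton X.V := by
  rw [IsZero.iff_id_eq_zero]
  constructor
  · intro h
    refine subsingleton_of_forall_eq 0 fun v => ?_
    exact LinearMap.congr_fun (congrArg Hom.lin h) v
  · intro h
    ext v
    exact Subsingleton.elim _ _

theorem not_isZero_iff {X : FDMod k H} : ¬ IsZero X ↔ ∃ v : X.V, v ≠ 0 := by
  rw [isZero_iff, not_subsingleton_iff_nontrivial, nontrivial_iff_exists_ne 0]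

theorem not_isZero_tensor {X Y : FDMod k H} (hX : ¬ IsZero X) (hY : ¬ IsZero Y) :
    ¬ IsZero (X ⊗ Y) := by
  rw [isZero_iff, not_subsingleton_iff_nontrivial] at *
  change Nontrivial (X.V ⊗[k] Y.V)
  infer_instance

@[simp]
theorem sum_lin {M N : FDMod k H} {ι : Type*} (s : Finset ι) (f : ι → (M ⟶ N)) :
    Hom.lin (∑ i ∈ s, f i : M ⟶ N) = ∑ i ∈ s, (f i).lin := by
  classical
  induction s using Finset.induction_on with
  | empty => rfl
  | insert a s ha ih => rw [Finset.sum_insert ha, Finset.sum_insert ha, add_lin, ih]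

/-- The isomorphism `V ⊗ W ≅ W ⊗ V` given by the almost cocommutativity of `H`. -/
theorem nonempty_tensor_comm (hH : IsAlmostCocommutative k H) (X Y : FDMod k H) :
    Nonempty (X ⊗ Y ≅ Y ⊗ X) := by
  obtain ⟨R, hR⟩ := hH
  -- The braiding-like map is the action of R followed by the flip; RΔ(h) = τ(Δ(h))R makes it
  -- H-linear.
  let e : (X.V ⊗[k] Y.V) ≃ₗ[k] (X.V ⊗[k] Y.V) :=
    LinearEquiv.ofLinearMap (TensorAction.extAct X.act Y.act R)
      (TensorAction.extAct X.act Y.act (R⁻¹ : (H ⊗[k] H)ˣ))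
      (by rw [← Module.End.mul_eq_comp, ← map_mul, Units.mul_inv, map_one]; rfl)
      (by rw [← Module.End.mul_eq_comp, ← map_mul, Units.inv_mul, map_one]; rfl)
  refine ⟨isoOfEquiv (M := tensor X Y) (N := tensor Y X)
    (e.trans (TensorProduct.comm k X.V Y.V)) fun h t => ?_⟩
  have h1 : (R : H ⊗[k] H) * Coalgebra.comul h =
      TensorProduct.comm k H H (Coalgebra.comul h) * (R : H ⊗[k] H) := by
    rw [hR, mul_assoc, Units.inv_mul, mul_one]
  have h2 : ∀ a : H ⊗[k] H, TensorProduct.comm k H H (TensorProduct.comm k H H a) = a :=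
    (TensorProduct.comm k H H).symm_apply_apply
  have key : ∀ t : X.V ⊗[k] Y.V,
      TensorProduct.comm k X.V Y.V (TensorAction.extAct X.act Y.act R
        (TensorAction.extAct X.act Y.act (Coalgebra.comul h) t)) =
      TensorAction.extAct Y.act X.act (Coalgebra.comul h) (TensorProduct.comm k X.V Y.V
        (TensorAction.extAct X.act Y.act R t)) := by
    intro t
    rw [← Module.End.mul_apply, ← map_mul, h1, map_mul, Module.End.mul_apply,
      TensorAction.comm_extAct, h2]
  exact key t

/-! ### The regular module -/

section Regular

variable [Module.Finite k H]

variable (k H) in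
/-- The regular module, transported to the universe of `k`. -/
def regular : FDMod k H where
  V := Fin (Module.finrank k H) → k
  act := ((Module.finBasis k H).equivFun.conjAlgEquiv k).toAlgHom.comp (Algebra.lmul k H)

variable (k H) in
/-- The identification of `H` with the space underlying the regular module. -/
def regularEquiv : H ≃ₗ[k] (regular k H).V :=
  (Module.finBasis k H).equivFun

theorem regular_act (h x : H) :
    (regular k H).act h (regularEquiv k H x) = regularEquiv k H (h * x) := by
  change regularEquiv k H (h * (regularEquiv k H).symm (regularEquiv k H x)) = _
  rw [LinearEquiv.symm_apply_apply]

/-- The homomorphism from the regular module that maps `1` to `v`. -/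
def ofRegular {M : FDMod k H} (v : M.V) : regular k H ⟶ M where
  lin := (LinearMap.applyₗ v ∘ₗ M.act.toLinearMap) ∘ₗ (regularEquiv k H).symm.toLinearMap
  comm h x := by
    obtain ⟨x, rfl⟩ := (regularEquiv k H).surjective x
    rw [regular_act]
    simp

theorem ofRegular_apply {M : FDMod k H} (v : M.V) (x : (regular k H).V) :
    (ofRegular v).lin x = M.act ((regularEquiv k H).symm x) v := rfl

theorem not_isZero_regular : ¬ IsZero (regular k H) := by
  rw [isZero_iff]
  intro h
  have h1 : regularEquiv k H 1 = 0 := h.elim _ _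
  rw [LinearEquiv.map_eq_zero_iff] at h1
  have := congrArg (Coalgebra.counit (R := k)) h1
  simp at this

end Regular

end FDMod

end Modules

/-! ### Decompositions into homogeneous components -/

namespace GroupGrading

section Preadditive

variable {C : Type*} [Category C] [Preadditive C] [MonoidalCategory C] {G : Type*} [Group G]

/-- A finite direct sum decomposition into homogeneous objects, with its total identity. -/
theorem exists_total (d : GroupGrading C G) (X : C) :
    ∃ (S : Finset G) (Y : S → C) (i : ∀ x, Y x ⟶ X) (p : ∀ x, X ⟶ Y x),
      (∀ x : S, d.component x (Y x)) ∧ (∀ x, i x ≫ p x = 𝟙 (Y x)) ∧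
        ∑ x, p x ≫ i x = 𝟙 X := by
  obtain ⟨S, Y, b, hY, ⟨hb⟩, ⟨e⟩⟩ := d.exists_decomposition X
  refine ⟨S, Y, fun x => b.ι x ≫ e.inv, fun x => e.hom ≫ b.π x, hY, fun x => by simp, ?_⟩
  have h : ∀ x : S, (e.hom ≫ b.π x) ≫ b.ι x ≫ e.inv = e.hom ≫ (b.π x ≫ b.ι x) ≫ e.inv := by
    simp
  simp only [h]
  rw [← Preadditive.comp_sum, ← Preadditive.sum_comp, IsBilimit.total hb]
  simp

theorem exists_ne_zero_component (d : GroupGrading C G) {X : C} (hX : ¬ IsZero X) :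
    ∃ (x : G) (Y : C) (i : Y ⟶ X) (p : X ⟶ Y), d.component x Y ∧ ¬ IsZero Y ∧ i ≫ p = 𝟙 Y := by
  obtain ⟨S, Y, i, p, hY, hip, ht⟩ := d.exists_total X
  by_contra! h
  apply hX
  rw [IsZero.iff_id_eq_zero, ← ht]
  refine Finset.sum_eq_zero fun x _ => ?_
  have h0 : IsZero (Y x) := by
    by_contra h0
    exact h x (Y x) (i x) (p x) (hY x) h0 (hip x)
  rw [h0.eq_of_tgt (p x) 0, zero_comp]

/-- An object is homogeneous if its other components vanish. -/
theorem component_of_isZero (d : GroupGrading C G) {X : C} (x : G)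
    (h : ∀ (y : G) (Y : C) (i : Y ⟶ X) (p : X ⟶ Y), d.component y Y → i ≫ p = 𝟙 Y → y ≠ x →
      IsZero Y) : d.component x X := by
  obtain ⟨S, Y, i, p, hY, hip, ht⟩ := d.exists_total X
  have h0 : ∀ y : S, (y : G) ≠ x → p y ≫ i y = 0 := fun y hy => by
    rw [(h y (Y y) (i y) (p y) (hY y) (hip y) hy).eq_of_tgt (p y) 0, zero_comp]
  by_cases hx : x ∈ S
  · refine d.of_iso ⟨i ⟨x, hx⟩, p ⟨x, hx⟩, hip _, ?_⟩ (hY ⟨x, hx⟩)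
    rw [← ht, Finset.sum_eq_single ⟨x, hx⟩ (fun y _ hy => h0 y fun h => hy (Subtype.ext h))]
    simp
  -- If x is not among the indices, every summand vanishes, and the zero object lies in all
  -- components.
  · refine d.zero_mem x ((IsZero.iff_id_eq_zero X).2 ?_)
    rw [← ht]
    exact Finset.sum_eq_zero fun y _ => h0 y fun h => hx (h ▸ y.2)

/-- Otherwise the identity of X would be a morphism between different components, hence zero. -/
theorem eq_of_component (d : GroupGrading C G) {X : C} (hX : ¬ IsZero X) {x y : G}
    (hx : d.component x X) (hy : d.component y X) : x = y := by
  by_contra h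
  exact hX ((IsZero.iff_id_eq_zero X).2 (d.hom_eq_zero h hx hy _))

/-- A faithful grading is universal if each of its components is contained in a component of any
other grading. -/
theorem isUniversal_of_forall_exists {U : Type w} [Group U] (d : GroupGrading C U)
    (htensor : ∀ {X Y : C}, ¬ IsZero X → ¬ IsZero Y → ¬ IsZero (X ⊗ Y)) (hd : d.IsFaithful)
    (h : ∀ (G : Type w) [Group G] (e : GroupGrading C G) (u : U),
      ∃ x : G, ∀ X, d.component u X → e.component x X) : d.IsUniversal := by
  refine ⟨hd, fun G _ e => ?_⟩
  choose φ hφ using h G e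
  refine ⟨MonoidHom.mk' φ fun a b => ?_, hφ, fun ψ hψ => ?_⟩
  -- Multiplicativity: X ⊗ Y is nonzero and lies in the components of both φ(ab) and φ(a)φ(b).
  · obtain ⟨X, hX, hX0⟩ := hd a
    obtain ⟨Y, hY, hY0⟩ := hd b
    exact e.eq_of_component (htensor hX0 hY0) (hφ _ _ (d.tensor_mem hX hY))
      (e.tensor_mem (hφ _ _ hX) (hφ _ _ hY))
  · ext u
    obtain ⟨X, hX, hX0⟩ := hd u
    exact e.eq_of_component hX0 (hψ u X hX) (hφ u X hX)

/-- The universal grading group is unique up to isomorphism. -/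
theorem IsUniversal.nonempty_mulEquiv {U U' : Type w} [Group U] [Group U']
    {d : GroupGrading C U} {d' : GroupGrading C U'} (hd : d.IsUniversal) (hd' : d'.IsUniversal) :
    Nonempty (U ≃* U') := by
  obtain ⟨φ, hφ, -⟩ := hd.2 U' d'
  obtain ⟨ψ, hψ, -⟩ := hd'.2 U d
  refine ⟨φ.toMulEquiv ψ ?_ ?_⟩
  -- Both the composite and the identity carry d to itself, so uniqueness identifies them.
  · exact (hd.2 U d).unique (fun u X h => hψ _ _ (hφ _ _ h)) fun u X h => h
  · exact (hd'.2 U' d').unique (fun u X h => hφ _ _ (hψ _ _ h)) fun u X h => h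

end Preadditive

end GroupGrading

/-! ### Modules over a Hopf algebra -/
/-! ### The grading by characters of the central group-like elements -/

section Characters

variable {k : Type u} [Field k] {H : Type v} [Ring H] [HopfAlgebra k H]

namespace centralGroupLikes

instance : CommGroup (centralGroupLikes k H) where
  mul_comm _ b := Subtype.ext (GroupLike.val_injective
    ((Subalgebra.mem_center_iff (R := k)).1 b.2 _))

/-- The element of `H` underlying a central group-like element. -/
def val : centralGroupLikes k H →* H where
  toFun g := (g : GroupLike k H)
  map_one' := rfl
  map_mul' _ _ := rfl

theorem val_mem_center (g : centralGroupLikes k H) (h : H) : h * val g = val g * h :=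
  (Subalgebra.mem_center_iff (R := k)).1 g.2 h

theorem comul_val (g : centralGroupLikes k H) :
    Coalgebra.comul (R := k) (val g) = val g ⊗ₜ[k] val g :=
  (g : GroupLike k H).2.comul_eq_tmul_self

/-- Needed twice: it bounds the number of central group-likes, and it shows that the idempotents
`charIdem` are nonzero. -/
theorem linearIndependent_val : LinearIndependent k (val (k := k) (H := H)) :=
  (linearIndep_groupLikeVal (R := k) (A := H)).comp _ Subtype.val_injective

instance [Module.Finite k H] : Finite (centralGroupLikes k H) :=
  (linearIndependent_val (k := k) (H := H)).finite

theorem tensor_act (g : centralGroupLikes k H) {X Y : FDMod k H} {a b : k}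
    (hX : ∀ v, X.act (val g) v = a • v) (hY : ∀ v, Y.act (val g) v = b • v) (v : (X ⊗ Y).V) :
    (X ⊗ Y).act (val g) v = (a * b) • v := by
  have key : ∀ t : X.V ⊗[k] Y.V, TensorAction.comulAct X.act Y.act (val g) t = (a * b) • t := by
    intro t
    rw [TensorAction.comulAct_apply, comul_val]
    induction t with
    | zero => simp
    | add s t hs ht => rw [map_add, hs, ht, smul_add]
    | tmul x y =>
      rw [TensorAction.extAct_tmul, hX, hY, TensorProduct.smul_tmul_smul]
  exact key v

end centralGroupLikes

open centralGroupLikes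

namespace FDMod

/-- The submodule on which the central group-like elements act through the character `χ`. -/
def weightSpace (X : FDMod k H) (χ : centralGroupLikes k H →* kˣ) : Submodule k X.V where
  carrier := {v | ∀ g, X.act (val g) v = (χ g : k) • v}
  add_mem' hv hw g := by rw [map_add, hv g, hw g, smul_add]
  zero_mem' g := by simp
  smul_mem' c v hv g := by rw [map_smul, hv g, smul_comm]

/-- Here centrality of the group-likes is used: it makes the weight spaces H-submodules. -/
theorem act_mem_weightSpace (X : FDMod k H) (χ : centralGroupLikes k H →* kˣ) (h : H) {v : X.V}
    (hv : v ∈ X.weightSpace χ) : X.act h v ∈ X.weightSpace χ := fun g => by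
  rw [← Module.End.mul_apply, ← map_mul, ← val_mem_center, map_mul, Module.End.mul_apply, hv g,
    map_smul]

/-- The `H`-submodule on which the central group-like elements act through `χ`. -/
def weightObj (X : FDMod k H) (χ : centralGroupLikes k H →* kˣ) : FDMod k H where
  V := X.weightSpace χ
  act :=
    { toFun h := (X.act h).restrict fun _ hv => X.act_mem_weightSpace χ h hv
      map_one' := by ext; simp
      map_mul' a b := by ext; simp
      map_zero' := by ext; simp
      map_add' a b := by ext; simp
      commutes' c := by ext; simp }

/-- The inclusion of the `χ`-component. -/
def weightι (X : FDMod k H) (χ : centralGroupLikes k H →* kˣ) : X.weightObj χ ⟶ X where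
  lin := (X.weightSpace χ).subtype
  comm _ _ := rfl

end FDMod

/-! ### Central idempotents and orthogonality of characters -/

section Idempotents

variable [Fintype (centralGroupLikes k H)]

/-- The central idempotent of `H` attached to a character of the central group-like elements. -/
def charIdem (χ : centralGroupLikes k H →* kˣ) : H :=
  (Fintype.card (centralGroupLikes k H) : k)⁻¹ •
    ∑ g : centralGroupLikes k H, (χ g⁻¹ : k) • val g

theorem charIdem_central (χ : centralGroupLikes k H →* kˣ) (h : H) :
    h * charIdem χ = charIdem χ * h := by
  simp only [charIdem, mul_smul_comm, smul_mul_assoc, Finset.mul_sum, Finset.sum_mul,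
    val_mem_center]

theorem val_mul_charIdem (χ : centralGroupLikes k H →* kˣ) (g : centralGroupLikes k H) :
    val g * charIdem χ = (χ g : k) • charIdem χ := by
  rw [charIdem, mul_smul_comm, smul_comm (χ g : k)]
  congr 1
  rw [Finset.mul_sum, Finset.smul_sum]
  refine Fintype.sum_equiv (Equiv.mulLeft g) _ _ fun a => ?_
  rw [mul_smul_comm, ← map_mul, smul_smul, ← Units.val_mul, ← map_mul]
  simp

variable [CharZero k]

theorem card_centralGroupLikes_ne_zero :
    (Fintype.card (centralGroupLikes k H) : k) ≠ 0 :=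
  Nat.cast_ne_zero.2 Fintype.card_ne_zero

/-- The coefficient of the group-like 1 is, up to the invertible factor |C|⁻¹, the unit χ(1). -/
theorem charIdem_ne_zero (χ : centralGroupLikes k H →* kˣ) : charIdem χ ≠ 0 := by
  intro h
  rw [charIdem, smul_eq_zero_iff_right (inv_ne_zero card_centralGroupLikes_ne_zero)] at h
  have h1 := Fintype.linearIndependent_iff.1 (linearIndependent_val (k := k) (H := H))
    (fun g => (χ g⁻¹ : k)) h 1
  exact (χ 1⁻¹).ne_zero h1

-- First orthogonality relation: the idempotent acts by the average of χ⁻¹χ' over the group, which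
-- is 1 or 0.
open scoped Classical in
theorem charIdem_act {X : FDMod k H} (χ χ' : centralGroupLikes k H →* kˣ) {v : X.V}
    (hv : v ∈ X.weightSpace χ') :
    X.act (charIdem χ) v = if χ' = χ then v else 0 := by
  have h1 : X.act (charIdem χ) v = ((Fintype.card (centralGroupLikes k H) : k)⁻¹ *
      ∑ g, (Units.coeHom k).comp (χ⁻¹ * χ') g) • v := by
    have h2 : ∀ g, X.act (val g) v = (χ' g : k) • v := hv
    rw [charIdem, map_smul, LinearMap.smul_apply, mul_smul, map_sum, LinearMap.sum_apply,
      Finset.sum_smul]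
    congr 1
    refine Finset.sum_congr rfl fun g _ => ?_
    rw [map_smul, LinearMap.smul_apply, h2, smul_smul]
    simp
  have h3 : (Units.coeHom k).comp (χ⁻¹ * χ') = 1 ↔ χ' = χ := by
    constructor
    · intro h
      refine MonoidHom.ext fun g => ?_
      have h4 : (χ g)⁻¹ * χ' g = 1 := Units.ext (DFunLike.congr_fun h g)
      exact (inv_mul_eq_one.1 h4).symm
    · rintro rfl
      ext g
      simp
  rw [h1, sum_hom_units]
  by_cases h : χ' = χ
  · rw [if_pos (h3.2 h), if_pos h, inv_mul_cancel₀ card_centralGroupLikes_ne_zero, one_smul]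
  · rw [if_neg (mt h3.1 h), if_neg h, Nat.cast_zero, mul_zero, zero_smul]

/-- Second orthogonality relation: the sum of χ(g⁻¹) over all χ is |C| for g = 1 and 0 otherwise.
This needs that characters separate points and that there are |C| of them. -/
theorem sum_charIdem [IsAlgClosed k] [Fintype (centralGroupLikes k H →* kˣ)] :
    ∑ χ : centralGroupLikes k H →* kˣ, charIdem χ = 1 := by
  classical
  -- The exponent is invertible in k, so k has enough roots of unity for the duality of finite
  -- abelian groups.
  have hn : NeZero (Monoid.exponent (centralGroupLikes k H) : k) :=
    ⟨Nat.cast_ne_zero.2 Monoid.exponent_ne_zero_of_finite⟩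
  have hsum : ∀ g : centralGroupLikes k H, ∑ χ : centralGroupLikes k H →* kˣ, (χ g⁻¹ : k) =
      if g = 1 then (Fintype.card (centralGroupLikes k H) : k) else 0 := by
    intro g
    -- Evaluation at g⁻¹ is regarded as a character of the character group.
    have h1 := sum_hom_units ((Units.coeHom k).comp
      (MonoidHom.eval g⁻¹ : (centralGroupLikes k H →* kˣ) →* kˣ))
    have h2 : (Units.coeHom k).comp
        (MonoidHom.eval g⁻¹ : (centralGroupLikes k H →* kˣ) →* kˣ) = 1 ↔ g = 1 := by
      rw [← inv_eq_one, ← CommGroup.forall_apply_eq_apply_iff (centralGroupLikes k H) (M := k)]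
      constructor
      · intro h χ
        rw [map_one]
        exact Units.ext (DFunLike.congr_fun h χ)
      · intro h
        ext χ
        simpa using congrArg Units.val (h χ)
    have h3 := CommGroup.card_monoidHom_of_hasEnoughRootsOfUnity (centralGroupLikes k H) k
    rw [Nat.card_eq_fintype_card, Nat.card_eq_fintype_card] at h3
    rw [← h3]
    simp only [h2, Nat.cast_ite, Nat.cast_zero] at h1
    exact h1
  simp only [charIdem]
  rw [← Finset.smul_sum, Finset.sum_comm]
  simp only [← Finset.sum_smul, hsum, ite_smul, zero_smul]
  rw [Finset.sum_ite_eq' Finset.univ (1 : centralGroupLikes k H), if_pos (Finset.mem_univ _),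
    smul_smul, inv_mul_cancel₀ card_centralGroupLikes_ne_zero, one_smul, map_one]

/-- The projection onto the `χ`-component. -/
def FDMod.weightπ (X : FDMod k H) (χ : centralGroupLikes k H →* kˣ) : X ⟶ X.weightObj χ where
  lin := (X.act (charIdem χ)).codRestrict (X.weightSpace χ) fun v g => by
    rw [← Module.End.mul_apply, ← map_mul, val_mul_charIdem, map_smul, LinearMap.smul_apply]
  comm h v := by
    refine Subtype.ext ?_
    change X.act (charIdem χ) (X.act h v) = X.act h (X.act (charIdem χ) v)
    rw [← Module.End.mul_apply, ← map_mul, ← charIdem_central, map_mul, Module.End.mul_apply]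

open scoped Classical in
theorem weightι_comp_weightπ (X : FDMod k H) (χ χ' : centralGroupLikes k H →* kˣ) :
    X.weightι χ' ≫ X.weightπ χ =
      if h : χ' = χ then eqToHom (congrArg X.weightObj h) else 0 := by
  have h1 : ∀ v : X.weightSpace χ', X.act (charIdem χ) v = if χ' = χ then (v : X.V) else 0 :=
    fun v => charIdem_act χ χ' v.2
  split_ifs with h
  · subst h
    ext v
    refine Subtype.ext ((h1 v).trans ?_)
    rw [if_pos rfl]
    rfl
  · ext v
    refine Subtype.ext ((h1 v).trans ?_)
    rw [if_neg h]
    rfl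

end Idempotents

/-! ### The grading by characters and its faithfulness -/

section Grading

variable [CharZero k] [IsAlgClosed k] [Module.Finite k H]

/-- The grading of the category of finite dimensional `H`-modules by the character group of the
group of central group-like elements. -/
def characterGrading {U : Type w} [Group U] (ev : U ≃* (centralGroupLikes k H →* kˣ)) :
    GroupGrading (FDMod k H) U where
  component u X := ∀ g v, X.act (val g) v = (ev u g : k) • v
  of_iso {x X Y} e hX g v := by
    have h1 : ∀ v, e.hom.lin (e.inv.lin v) = v := fun v =>
      LinearMap.congr_fun (congrArg FDMod.Hom.lin e.inv_hom_id) v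
    rw [← h1 v, ← e.hom.comm, hX, map_smul]
  zero_mem x X hX g v := by
    have := FDMod.isZero_iff.1 hX
    exact Subsingleton.elim _ _
  hom_eq_zero {x y} hxy X Y hX hY f := by
    obtain ⟨g, hg⟩ : ∃ g, ev x g ≠ ev y g := by
      by_contra! h
      exact hxy (ev.injective (MonoidHom.ext h))
    ext v
    have h1 := f.comm (val g) v
    rw [hX, hY, map_smul, ← sub_eq_zero, ← sub_smul, smul_eq_zero, sub_eq_zero] at h1
    exact h1.resolve_left fun h => hg (Units.ext h)
  exists_decomposition X := by
    classical
    have := Fintype.ofFinite (centralGroupLikes k H)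
    have hn : NeZero (Monoid.exponent (centralGroupLikes k H) : k) :=
      ⟨Nat.cast_ne_zero.2 Monoid.exponent_ne_zero_of_finite⟩
    have : Finite (centralGroupLikes k H →* kˣ) :=
      Finite.of_equiv _
        (CommGroup.monoidHom_mulEquiv_of_hasEnoughRootsOfUnity (centralGroupLikes k H) k).some.symm.toEquiv
    have := Fintype.ofFinite (centralGroupLikes k H →* kˣ)
    have : Fintype U := Fintype.ofEquiv _ ev.symm.toEquiv
    -- All characters serve as indices; weight objects that happen to vanish do no harm.
    let b : Bicone fun x : (Finset.univ : Finset U) => X.weightObj (ev x) :=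
      { pt := X
        π x := X.weightπ (ev x)
        ι x := X.weightι (ev x)
        ι_π x y := by
          rw [weightι_comp_weightπ]
          by_cases h : x = y
          · subst h
            simp
          · rw [dif_neg h, dif_neg]
            exact fun h' => h (Subtype.ext (ev.injective h')) }
    refine ⟨Finset.univ, _, b, fun x g v => Subtype.ext (v.2 g), ⟨isBilimitOfTotal b ?_⟩,
      ⟨Iso.refl _⟩⟩
    ext v
    rw [FDMod.sum_lin, LinearMap.sum_apply]
    have h1 : ∀ x : (Finset.univ : Finset U), (b.π x ≫ b.ι x).lin v =
      X.act (charIdem (ev x)) v := fun _ => rfl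
    simp only [h1]
    rw [← LinearMap.sum_apply, ← map_sum]
    have h2 : ∑ x : (Finset.univ : Finset U), charIdem (ev x) = 1 := by
      rw [Finset.univ_eq_attach, Finset.sum_attach Finset.univ fun x => charIdem (ev x),
        ← sum_charIdem (k := k) (H := H)]
      exact Fintype.sum_equiv ev.toEquiv _ _ fun _ => rfl
    rw [h2, map_one]
    rfl
  tensor_mem {x y X Y} hX hY g v := by
    rw [tensor_act g (hX g) (hY g), map_mul, MonoidHom.mul_apply, Units.val_mul]

/-- The idempotent of a character is itself a nonzero weight vector in the regular module. -/
theorem characterGrading_isFaithful {U : Type w} [Group U]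
    (ev : U ≃* (centralGroupLikes k H →* kˣ)) : (characterGrading ev).IsFaithful := by
  have := Fintype.ofFinite (centralGroupLikes k H)
  intro u
  refine ⟨(FDMod.regular k H).weightObj (ev u), fun g v => Subtype.ext (v.2 g), ?_⟩
  rw [FDMod.not_isZero_iff]
  refine ⟨⟨FDMod.regularEquiv k H (charIdem (ev u)), fun g => ?_⟩, fun h => ?_⟩
  · rw [FDMod.regular_act, val_mul_charIdem, map_smul]
  · exact charIdem_ne_zero (ev u)
      ((FDMod.regularEquiv k H).map_eq_zero_iff.1 (congrArg Subtype.val h))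

end Grading

end Characters

/-! ### Modules over a Hopf algebra -/
/-! ### Central group-like elements from a grading -/

section Arbitrary

variable {k : Type u} [Field k] {H : Type v} [Ring H] [HopfAlgebra k H] {G : Type*} [Group G]

open centralGroupLikes

namespace GroupGrading

theorem sum_components {X : FDMod k H} {ι : Type*} [Fintype ι] {Y : ι → FDMod k H} {i : ∀ x, Y x ⟶ X}
    {p : ∀ x, X ⟶ Y x} (ht : ∑ x, p x ≫ i x = 𝟙 X) (v : X.V) :
    ∑ x, (i x).lin ((p x).lin v) = v := by
  have h := LinearMap.congr_fun (congrArg FDMod.Hom.lin ht) v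
  rw [FDMod.sum_lin, LinearMap.sum_apply] at h
  exact h

/-! ### The support of an arbitrary grading -/

variable (d : GroupGrading (FDMod k H) G)

/-- The elements of the group whose component is nonzero. -/
def support : Set G := {x | ∃ X, d.component x X ∧ ¬ IsZero X}

theorem mul_mem_support {x y : G} (hx : x ∈ d.support) (hy : y ∈ d.support) :
    x * y ∈ d.support := by
  obtain ⟨X, hX, hX0⟩ := hx
  obtain ⟨Y, hY, hY0⟩ := hy
  exact ⟨X ⊗ Y, d.tensor_mem hX hY, FDMod.not_isZero_tensor hX0 hY0⟩

/-- The only use of almost cocommutativity: the nonzero modules X ⊗ Y and Y ⊗ X are isomorphic, so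
their degrees agree. -/
theorem mul_comm_of_mem_support (hH : IsAlmostCocommutative k H) {x y : G} (hx : x ∈ d.support)
    (hy : y ∈ d.support) : x * y = y * x := by
  obtain ⟨X, hX, hX0⟩ := hx
  obtain ⟨Y, hY, hY0⟩ := hy
  obtain ⟨e⟩ := FDMod.nonempty_tensor_comm hH X Y
  exact d.eq_of_component (FDMod.not_isZero_tensor hY0 hX0) (d.of_iso e (d.tensor_mem hX hY))
    (d.tensor_mem hY hX)

/-- Only positive powers are treated, because 1 is not yet known to lie in the support. -/
theorem pow_succ_mem_support {x : G} (hx : x ∈ d.support) (n : ℕ) : x ^ (n + 1) ∈ d.support := by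
  induction n with
  | zero => simpa using hx
  | succ n ih => exact pow_succ x (n + 1) ▸ d.mul_mem_support ih hx

variable [Module.Finite k H]

/-- The regular module is faithful and is a sum of homogeneous modules. -/
theorem ext_of_act {h h' : H}
    (H0 : ∀ x (X : FDMod k H), d.component x X → ∀ v, X.act h v = X.act h' v) : h = h' := by
  obtain ⟨S, Y, i, p, hY, -, ht⟩ := d.exists_total (FDMod.regular k H)
  have h1 : ∀ v, (FDMod.regular k H).act h v = (FDMod.regular k H).act h' v := by
    intro v
    rw [← sum_components ht v]
    simp only [map_sum]
    refine Finset.sum_congr rfl fun x _ => ?_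
    rw [← (i x).comm, ← (i x).comm, H0 x (Y x) (hY x)]
  have h2 := h1 (FDMod.regularEquiv k H 1)
  rw [FDMod.regular_act, FDMod.regular_act] at h2
  simpa using (FDMod.regularEquiv k H).injective h2

/-- The same argument for H ⊗ H acting on the tensor square of the regular module, evaluated at 1 ⊗
1. -/
theorem ext_of_extAct {t t' : H ⊗[k] H}
    (H0 : ∀ x y (X Y : FDMod k H), d.component x X → d.component y Y → ∀ v w,
      TensorAction.extAct X.act Y.act t (v ⊗ₜ w) = TensorAction.extAct X.act Y.act t' (v ⊗ₜ w)) :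
    t = t' := by
  obtain ⟨S, Y, i, p, hY, -, ht⟩ := d.exists_total (FDMod.regular k H)
  have h1 : ∀ v w, TensorAction.extAct (FDMod.regular k H).act (FDMod.regular k H).act t (v ⊗ₜ w) =
      TensorAction.extAct (FDMod.regular k H).act (FDMod.regular k H).act t' (v ⊗ₜ w) := by
    intro v w
    rw [← sum_components ht v, ← sum_components ht w]
    simp only [TensorProduct.sum_tmul, TensorProduct.tmul_sum, map_sum]
    refine Finset.sum_congr rfl fun x _ => Finset.sum_congr rfl fun y _ => ?_
    rw [← TensorAction.extAct_map _ _ _ _ _ _ (i y).comm (i x).comm,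
      ← TensorAction.extAct_map _ _ _ _ _ _ (i y).comm (i x).comm,
      H0 y x _ _ (hY y) (hY x)]
  have h2 : ∀ t : H ⊗[k] H,
      TensorAction.extAct (FDMod.regular k H).act (FDMod.regular k H).act t
        (FDMod.regularEquiv k H 1 ⊗ₜ FDMod.regularEquiv k H 1) =
      TensorProduct.congr (FDMod.regularEquiv k H) (FDMod.regularEquiv k H) t := by
    intro t
    induction t with
    | zero => simp
    | add x y hx hy => simp only [map_add, LinearMap.add_apply, hx, hy]
    | tmul a b =>
      rw [TensorAction.extAct_tmul, FDMod.regular_act, FDMod.regular_act, mul_one, mul_one,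
        TensorProduct.congr_tmul]
  have h3 := h1 (FDMod.regularEquiv k H 1) (FDMod.regularEquiv k H 1)
  rw [h2, h2] at h3
  exact (TensorProduct.congr _ _).injective h3

/-- For every function `f` there is an element of `H` acting on each component by the scalar given
by `f`. -/
theorem exists_scalar (f : G → k) :
    ∃ z : H, ∀ x (X : FDMod k H), d.component x X → ∀ v, X.act z v = f x • v := by
  obtain ⟨S, Y, i, p, hY, -, ht⟩ := d.exists_total (FDMod.regular k H)
  -- With 1 = ∑ 1_x the homogeneous decomposition of the unit of H, the witness is ∑ f(x) 1_x.
  refine ⟨∑ x : S, f x • (FDMod.regularEquiv k H).symm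
    ((i x).lin ((p x).lin (FDMod.regularEquiv k H 1))), fun x X hX v => ?_⟩
  have h1 : (FDMod.ofRegular v).lin (FDMod.regularEquiv k H 1) = v := by
    rw [FDMod.ofRegular_apply, LinearEquiv.symm_apply_apply, map_one]
    rfl
  conv_rhs => rw [← h1, ← sum_components ht (FDMod.regularEquiv k H 1)]
  rw [map_sum, map_sum, LinearMap.sum_apply, Finset.smul_sum]
  refine Finset.sum_congr rfl fun y _ => ?_
  rw [map_smul, LinearMap.smul_apply, ← FDMod.ofRegular_apply]
  by_cases h : (y : G) = x
  · rw [h]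
  -- The part 1_y kills v when y ≠ x, since no nonzero morphism leads from degree y to degree x.
  · have h2 : (FDMod.ofRegular v).lin ((i y).lin ((p y).lin (FDMod.regularEquiv k H 1))) = 0 := by
      have h3 := congrArg FDMod.Hom.lin
        (d.hom_eq_zero h (hY y) hX (i y ≫ FDMod.ofRegular v))
      exact LinearMap.congr_fun h3 _
    rw [h2, smul_zero, smul_zero]

/-- A nonzero homogeneous module receives a nonzero map from the regular module, so its degree
occurs in the finite decomposition of the latter. -/
theorem finite_support : d.support.Finite := by
  obtain ⟨S, Y, i, p, hY, -, ht⟩ := d.exists_total (FDMod.regular k H)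
  refine S.finite_toSet.subset ?_
  rintro x ⟨X, hX, hX0⟩
  by_contra hx
  obtain ⟨v, hv⟩ := FDMod.not_isZero_iff.1 hX0
  have h0 : FDMod.ofRegular (H := H) v = 0 := by
    rw [← Category.id_comp (FDMod.ofRegular v), ← ht, Preadditive.sum_comp]
    refine Finset.sum_eq_zero fun y _ => ?_
    rw [Category.assoc, d.hom_eq_zero (fun h => hx (by rw [← h]; exact y.2)) (hY y) hX (i y ≫ _), comp_zero]
  have h1 := LinearMap.congr_fun (congrArg FDMod.Hom.lin h0) (FDMod.regularEquiv k H 1)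
  rw [FDMod.ofRegular_apply, LinearEquiv.symm_apply_apply, map_one] at h1
  exact hv h1

theorem isOfFinOrder_of_mem_support {x : G} (hx : x ∈ d.support) : IsOfFinOrder x := by
  rw [← finite_powers]
  refine (d.finite_support.insert 1).subset ?_
  rintro _ ⟨_ | n, rfl⟩
  · exact Or.inl (pow_zero x)
  · exact Or.inr (d.pow_succ_mem_support hx n)

theorem exists_pow_succ_eq_one {x : G} (hx : x ∈ d.support) : ∃ n : ℕ, x ^ (n + 1) = 1 := by
  obtain ⟨n, hn, h⟩ := isOfFinOrder_iff_pow_eq_one.1 (d.isOfFinOrder_of_mem_support hx)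
  exact ⟨n - 1, by rwa [Nat.sub_add_cancel hn]⟩

/-- The support of a grading is a subgroup. -/
def supportSubgroup : Subgroup G where
  carrier := d.support
  mul_mem' := d.mul_mem_support
  one_mem' := by
    obtain ⟨x, Y, -, -, hY, hY0, -⟩ := d.exists_ne_zero_component
      (FDMod.not_isZero_regular (k := k) (H := H))
    have hx : x ∈ d.support := ⟨Y, hY, hY0⟩
    obtain ⟨n, hn⟩ := d.exists_pow_succ_eq_one hx
    exact hn ▸ d.pow_succ_mem_support hx n
  inv_mem' {x} hx := by
    obtain ⟨n, hn⟩ := d.exists_pow_succ_eq_one hx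
    -- The inverse is already x ^ n, but n may be 0; the exponent 2n + 1 is certainly positive.
    have h : x⁻¹ = x ^ (n + n + 1) := by
      rw [add_assoc, pow_add, hn, mul_one, inv_eq_iff_mul_eq_one, ← pow_succ', hn]
    exact h ▸ d.pow_succ_mem_support hx _

theorem mem_supportSubgroup {x : G} {X : FDMod k H} (hX : d.component x X) (hX0 : ¬ IsZero X) :
    x ∈ d.supportSubgroup := ⟨X, hX, hX0⟩

instance : Finite d.supportSubgroup := d.finite_support

/-- The support of a grading of the modules over an almost cocommutative Hopf algebra is
commutative. -/
abbrev supportCommGroup (hH : IsAlmostCocommutative k H) : CommGroup d.supportSubgroup where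
  mul_comm x y := Subtype.ext (d.mul_comm_of_mem_support hH x.2 y.2)

/-- An element acting on the components of a grading through a character of its support is
group-like. -/
theorem isGroupLikeElem_of_act (ψ : d.supportSubgroup →* kˣ) {z : H}
    (hz : ∀ (x : d.supportSubgroup) (X : FDMod k H), d.component x X →
      ∀ v, X.act z v = (ψ x : k) • v) : IsGroupLikeElem k z := by
  have hcomul : Coalgebra.comul (R := k) z = z ⊗ₜ[k] z := by
    -- On X ⊗ Y, Δ(z) acts by ψ(xy) and z ⊗ z by ψ(x)ψ(y).
    refine d.ext_of_extAct fun x y X Y hX hY v w => ?_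
    by_cases hX0 : IsZero X
    · have := FDMod.isZero_iff.1 hX0
      rw [Subsingleton.elim v 0, TensorProduct.zero_tmul, map_zero, map_zero]
    by_cases hY0 : IsZero Y
    · have := FDMod.isZero_iff.1 hY0
      rw [Subsingleton.elim w 0, TensorProduct.tmul_zero, map_zero, map_zero]
    have h1 := hz (⟨x, d.mem_supportSubgroup hX hX0⟩ * ⟨y, d.mem_supportSubgroup hY hY0⟩) _
      (d.tensor_mem hX hY) (v ⊗ₜ[k] w)
    rw [TensorAction.extAct_tmul, hz ⟨x, d.mem_supportSubgroup hX hX0⟩ X hX,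
      hz ⟨y, d.mem_supportSubgroup hY hY0⟩ Y hY, TensorProduct.smul_tmul_smul, ← Units.val_mul,
      ← map_mul]
    exact h1
  -- From ε(z)z = z and the identity action of z on a nonzero module of degree 1 it follows that
  -- ε(z) = 1, without determining the degree of the unit object.
  obtain ⟨X, hX, hX0⟩ := d.supportSubgroup.one_mem
  obtain ⟨v, hv⟩ := FDMod.not_isZero_iff.1 hX0
  have h1 : Coalgebra.counit (R := k) z • z = z := by
    have h2 := Coalgebra.rTensor_counit_comul (R := k) z
    rw [hcomul, LinearMap.rTensor_tmul] at h2
    simpa using congrArg (TensorProduct.lid k H) h2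
  refine ⟨?_, hcomul⟩
  have h3 := congrArg (fun h => X.act h v) h1
  simp only [map_smul, LinearMap.smul_apply, hz 1 X hX v, map_one, Units.val_one, one_smul] at h3
  rw [← sub_eq_zero, ← one_smul k v, smul_smul, ← sub_smul, smul_eq_zero, mul_one,
    sub_eq_zero] at h3
  exact h3.resolve_right hv

/-- A character of the support of a grading gives a central group-like element. -/
theorem exists_centralGroupLike (ψ : d.supportSubgroup →* kˣ) :
    ∃ g : centralGroupLikes k H, ∀ (x : d.supportSubgroup) (X : FDMod k H), d.component x X →
      ∀ v, X.act (val g) v = (ψ x : k) • v := by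
  classical
  obtain ⟨z, hz⟩ := d.exists_scalar fun x =>
    if h : x ∈ d.supportSubgroup then (ψ ⟨x, h⟩ : k) else 0
  have hz' : ∀ (x : d.supportSubgroup) (X : FDMod k H), d.component x X →
      ∀ v, X.act z v = (ψ x : k) • v := fun x X hX v => by
    rw [hz x X hX, dif_pos x.2]
  refine ⟨⟨⟨z, d.isGroupLikeElem_of_act ψ hz'⟩, ?_⟩, hz'⟩
  -- Centrality: z acts by a scalar on each homogeneous module, so it commutes there with every h.
  refine (Subalgebra.mem_center_iff (R := k)).2 fun h => d.ext_of_act fun x X hX v => ?_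
  rw [map_mul, map_mul, Module.End.mul_apply, Module.End.mul_apply, hz x X hX, hz x X hX, map_smul]

/-! ### Comparison of an arbitrary grading with the grading by characters -/

section Universal

variable [CharZero k] [IsAlgClosed k]

/-- Every component of the grading by characters is contained in a component of `d`. -/
theorem exists_component_of_characterGrading (hH : IsAlmostCocommutative k H) {U : Type w}
    [Group U] (ev : U ≃* (centralGroupLikes k H →* kˣ)) (u : U) :
    ∃ x : G, ∀ X, (characterGrading ev).component u X → d.component x X := by
  have hdirect : ∀ {X Y : FDMod k H} (i : Y ⟶ X) (p : X ⟶ Y), i ≫ p = 𝟙 Y →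
      (characterGrading ev).component u X → (characterGrading ev).component u Y := by
    intro X Y i p hip hX g v
    have h1 : ∀ v, p.lin (i.lin v) = v := fun v =>
      LinearMap.congr_fun (congrArg FDMod.Hom.lin hip) v
    rw [← h1 v, ← p.comm, hX, map_smul]
  -- The central group-like attached to ψ acts on Y by ψ(y) and on X by ψ(x), but also on both by
  -- the character of u. Hence ψ(x) = ψ(y) for all ψ, and characters of a finite abelian group
  -- separate points.
  have hsub : ∀ {x y : G} {X Y : FDMod k H}, (characterGrading ev).component u X →
      (characterGrading ev).component u Y → d.component x X → d.component y Y → ¬ IsZero X →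
      ¬ IsZero Y → y = x := by
    intro x y X Y hX hY hxX hyY hX0 hY0
    have hx := d.mem_supportSubgroup hxX hX0
    have hy := d.mem_supportSubgroup hyY hY0
    let := d.supportCommGroup hH
    have hn : NeZero (Monoid.exponent d.supportSubgroup : k) :=
      ⟨Nat.cast_ne_zero.2 Monoid.exponent_ne_zero_of_finite⟩
    refine congrArg Subtype.val (a₁ := (⟨y, hy⟩ : d.supportSubgroup)) (a₂ := ⟨x, hx⟩)
      ((CommGroup.forall_apply_eq_apply_iff _ (M := k)).1 fun ψ => Units.ext ?_)
    obtain ⟨g, hg⟩ := d.exists_centralGroupLike ψ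
    obtain ⟨v, hv⟩ := FDMod.not_isZero_iff.1 hX0
    obtain ⟨w, hw⟩ := FDMod.not_isZero_iff.1 hY0
    rw [smul_left_injective k hw ((hg ⟨y, hy⟩ Y hyY w).symm.trans (hY g w)),
      smul_left_injective k hv ((hg ⟨x, hx⟩ X hxX v).symm.trans (hX g v))]
  -- The degree x is read off from any nonzero homogeneous summand of one nonzero object of the
  -- component of u.
  obtain ⟨X, hX, hX0⟩ := characterGrading_isFaithful ev u
  obtain ⟨x, Y, i, p, hY, hY0, hip⟩ := d.exists_ne_zero_component hX0
  refine ⟨x, fun X' hX' => d.component_of_isZero x fun y Y' i' p' hY' hip' hne => ?_⟩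
  by_contra hY0'
  exact hne (hsub (hdirect i p hip hX) (hdirect i' p' hip' hX') hY hY' hY0 hY0')

end Universal

end GroupGrading

end Arbitrary

end

theorem mainTheorem12 {k : Type u} [Field k] [IsAlgClosed k] [CharZero k]
    {H : Type v} [Ring H] [HopfAlgebra k H] [IsSemisimpleRing H]
    (hH : IsAlmostCocommutative k H) :
    (∃ (U : Type w) (_ : Group U) (d : GroupGrading (FDMod k H) U), d.IsUniversal) ∧
      ∀ (U : Type w) [Group U] (d : GroupGrading (FDMod k H) U), d.IsUniversal →
        Nonempty (U ≃* centralGroupLikes k H) := by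
  have := HopfAlgebra.finite_of_isSemisimpleRing k H
  have hn : NeZero (Monoid.exponent (centralGroupLikes k H) : k) :=
    ⟨Nat.cast_ne_zero.2 Monoid.exponent_ne_zero_of_finite⟩
  obtain ⟨E⟩ :=
    CommGroup.monoidHom_mulEquiv_of_hasEnoughRootsOfUnity (centralGroupLikes k H) k
  -- The finite group is moved to the universe w, over which universality quantifies.
  let ev : Shrink.{w} (centralGroupLikes k H) ≃* (centralGroupLikes k H →* kˣ) :=
    (Shrink.mulEquiv).trans E.symm
  have huniv : (characterGrading ev).IsUniversal :=
    GroupGrading.isUniversal_of_forall_exists _ FDMod.not_isZero_tensor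
      (characterGrading_isFaithful ev)
      fun G _ e u => e.exists_component_of_characterGrading hH ev u
  refine ⟨⟨_, _, _, huniv⟩, fun U _ d hd => ?_⟩
  obtain ⟨F⟩ := hd.nonempty_mulEquiv huniv
  exact ⟨F.trans Shrink.mulEquiv⟩
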